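/- **Setting.** Fix predicates with arities, constants, and infinitely many variables (no other function symbols). An atomset is a possibly infinite set of atoms. A nonmonotonic existential (NME) rule is $R=(B^+,\mathbf{not}\,B^-_1,\dots,\mathbf{not}\,B^-_k\to H)$ with $k\ge 0$, finite atomsets $B^+,B^-_q,H$ and $\mathrm{vars}(B^-_q)\subseteq \mathrm{vars}(B^+)$. Let $F$ be a finite atomset and $\mathcal R$ a set of NME rules. **Derivations and chases.** A finite or infinite derivation from $F$ consists of $F_0=F$, and $F_{i+1}=\sigma_i(F_i)\cup\pi_i(\mathrm{safe}(H))$ for a rule of $\mathcal R$ and a homomorphism $\pi_i$ from its $B^+$ to $\sigma_i(F_i)$, where $\mathrm{safe}(H)$ replaces the existential variables by distinct variables occurring in none of $F_0,\dots,F_i$. A chase criterion $C$ is a function that determines each $\sigma_i$ from the derivation up to $F_i$, such that $\sigma_i$ is a retraction of $F_i$ (an endomorphism of $F_i$ that is the identity on its image). A $C$-chase is a derivation whose $\sigma_i$ are those determined by $C$ and all of whose applications produce something new: $\sigma_{i+1}(F_{i+1})\not\subseteq\sigma_i(F_i)$. A derivation produces the atomset $\bigcup_i\sigma_i(F_i)\setminus\bigcup_i\bigl(F_i\setminus\sigma_i(F_i)\bigr)$.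 Put $\sigma_{i\to j}=\sigma_j\circ\dots\circ\sigma_{i+1}$. A derivation is sound if there is no application, made on $\sigma_i(F_i)$ by $\pi_i$, for which $\sigma_{i\to j}(\pi_i(B^-_q))\subseteq\sigma_j(F_j)$ for some $q$ and some $j\ge i$. A sound derivation is complete if for every $i$, every rule of $\mathcal R$ and every homomorphism $\pi$ from its $B^+$ to $\sigma_i(F_i)$ there is $j\ge i$ such that adding the application by $\sigma_{i\to j}\circ\pi$ to the part $F_0,\dots,F_j$ of the derivation (with simplification by $C$, for any choice of fresh variables, and whether or not it produces something new) makes that part unsound or does not change the atomset it produces. (For a finite derivation one may take $i$ and $j$ to be its last step.) An atomset $A$ is *$C$-stable* for $(F,\mathcal R)$ if some complete sound $C$-chase from $F$ with rules in $\mathcal R$ produces $A$. **Trees.** A $C$-derivation tree of $(F,\mathcal R)$ is a finite or infinite tree whose nodes are labelled by an atomset $\mathrm{IN}$ and two sets of atomsets $\mathrm{OUT}$, $\mathrm{MBT}$. The root has label $(\sigma_0(F),\emptyset,\emptyset)$. A node $N$ is unsound if some $B\in\mathrm{OUT}(N)$ satisfies $B\subseteq\mathrm{IN}(N)\cup\bigcup\mathrm{MBT}(N)$.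 A node is either a leaf or, if it is not unsound, has exactly the $k+1$ children $N^+,N^-_1,\dots,N^-_k$ given by one application of a rule of $\mathcal R$ by a homomorphism $\pi$ from $B^+$ to $\mathrm{IN}(N)$, with no $\pi(B^-_q)\subseteq\mathrm{IN}(N)$ and with $S\not\subseteq\mathrm{IN}(N)$, where $S$ is the atomset obtained by adding this application to the derivation encoded by the positive nodes from the root to $N$ and simplifying by $C$. The labels are $$N^+:\ (S,\ \mathrm{OUT}(N)\cup\{\pi(B^-_1),\dots,\pi(B^-_k)\},\ \mathrm{MBT}(N)),\qquad N^-_q:\ (\mathrm{IN}(N),\ \mathrm{OUT}(N),\ \mathrm{MBT}(N)\cup\{\pi(B^-_q)\}).$$ A branch is a maximal path from the root; its associated derivation is the one encoded by its positive nodes. A branch is unsound if it contains an unsound node, and sound otherwise. A sound branch is complete if its associated derivation is (sound and) complete. A sound and complete branch is stable if for every node $N$ on it and every $B\in\mathrm{MBT}(N)$ there is a node $N'$ on it, equal to $N$ or a descendant of $N$, with $B\subseteq\mathrm{IN}(N')$. A branch is unprovable if it contains a node $N$ with $\mathrm{MBT}(N)\neq\emptyset$ such that no complete branch of the tree containing $N$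 is stable. A *$C$-chase tree* is a $C$-derivation tree all of whose branches are unsound, unprovable or complete. **Proposition.** For every chase criterion $C$, every finite atomset $F$, every set $\mathcal R$ of NME rules and every atomset $A$: $A$ is $C$-stable for $(F,\mathcal R)$ if and only if some $C$-chase tree of $(F,\mathcal R)$ contains a stable branch whose associated derivation produces $A$. -/

import Mathlib

/-! Nonmonotonic existential rules, `C`-chases and `C`-chase trees. -/

namespace ChaseTree

/-- Terms of a vocabulary with constants `Con`, variables `Var` and no other function symbols. -/
inductive Term (Con Var : Type*) where
  | con (c : Con) : Term Con Var
  | var (x : Var) : Term Con Var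

/-- Substitutions; they act as the identity on constants. -/
abbrev Subst (Con Var : Type*) := Var → Term Con Var

def Term.subst {Con Var : Type*} (s : Subst Con Var) : Term Con Var → Term Con Var
  | .con c => .con c
  | .var x => s x

/-- Atoms `p(t₁, …, tₖ)`, where `k = ar p` is the arity of `p`. -/
structure Atom {Pred : Type*} (ar : Pred → ℕ) (Con Var : Type*) where
  pred : Pred
  args : Fin (ar pred) → Term Con Var

/-- A (possibly infinite) atomset. -/
abbrev Atomset {Pred : Type*} (ar : Pred → ℕ) (Con Var : Type*) := Set (Atom ar Con Var)

section

variable {Pred Con Var : Type*} {ar : Pred → ℕ}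

def Atom.subst (s : Subst Con Var) (p : Atom ar Con Var) : Atom ar Con Var :=
  ⟨p.pred, fun i => (p.args i).subst s⟩

/-- The image `s(F)` of an atomset under a substitution. -/
def image (s : Subst Con Var) (F : Atomset ar Con Var) : Atomset ar Con Var :=
  Atom.subst s '' F

/-- The variables that occur in an atomset. -/
def vars (F : Atomset ar Con Var) : Set Var :=
  {x | ∃ p ∈ F, ∃ i, p.args i = .var x}

end

/-- A nonmonotonic existential rule `pos, not neg 0, …, not neg (k-1) → head`. -/
structure NMERule {Pred : Type*} (ar : Pred → ℕ) (Con Var : Type*) where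
  pos : Atomset ar Con Var
  k : ℕ
  neg : Fin k → Atomset ar Con Var
  head : Atomset ar Con Var
  finite_pos : pos.Finite
  finite_neg : ∀ q, (neg q).Finite
  finite_head : head.Finite
  safe : ∀ q, vars (neg q) ⊆ vars pos

/-- The existential variables of a rule. -/
def NMERule.exVars {Pred Con Var : Type*} {ar : Pred → ℕ} (R : NMERule ar Con Var) : Set Var :=
  vars R.head \ vars R.pos

/-- The data of an application of (the positive part of) a rule: the homomorphism, of which only
the values on the variables of the positive body matter, and the renaming that replaces the
existential variables by fresh ones. -/
structure App {Pred : Type*} (ar : Pred → ℕ) (Con Var : Type*) where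
  rule : NMERule ar Con Var
  hom : Subst Con Var
  fresh : Var → Var

section

variable {Pred Con Var : Type*} {ar : Pred → ℕ}

open Classical in
/-- `π(safe(H))`. -/
noncomputable def App.headInst (a : App ar Con Var) : Atomset ar Con Var :=
  image (fun x => if x ∈ vars a.rule.pos then a.hom x else .var (a.fresh x)) a.rule.head

/-- `π(B⁻_q)`. -/
def App.negInst (a : App ar Con Var) (q : Fin a.rule.k) : Atomset ar Con Var :=
  image a.hom (a.rule.neg q)

end

/-- A finite derivation from `F` whose simplifications are determined by a criterion is recorded
by the list of its applications, **most recent first**; such a list is called a history, and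
`g <:+ h` says that `g` is an initial segment of the derivation `h`. A simplifier yields, for the
derivation `h` from `F` with last atomset `F_i`, the simplification `σ_i` of `F_i`. -/
abbrev Simplifier {Pred : Type*} (ar : Pred → ℕ) (Con Var : Type*) :=
  Atomset ar Con Var → List (App ar Con Var) → Subst Con Var

section

variable {Pred Con Var : Type*} {ar : Pred → ℕ}

/-- The unsimplified atomset `F_i` reached after `h`:
`F_0 = F` and `F_{i+1} = α(σ_i(F_i), R, π)`. -/
noncomputable def raw (σ : Simplifier ar Con Var) (F : Atomset ar Con Var) :
    List (App ar Con Var) → Atomset ar Con Var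
  | [] => F
  | a :: h => image (σ F h) (raw σ F h) ∪ a.headInst

/-- The simplified atomset `σ_i(F_i)` reached after `h`. -/
noncomputable def cur (σ : Simplifier ar Con Var) (F : Atomset ar Con Var)
    (h : List (App ar Con Var)) : Atomset ar Con Var :=
  image (σ F h) (raw σ F h)

/-- `a` is an application of a rule of `𝓡` after `h`: its homomorphism maps the positive body
into `σ_i(F_i)`, and it uses distinct variables that are fresh for the whole derivation. -/
def Applicable (σ : Simplifier ar Con Var) (F : Atomset ar Con Var) (𝓡 : Set (NMERule ar Con Var))
    (h : List (App ar Con Var)) (a : App ar Con Var) : Prop :=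
  a.rule ∈ 𝓡 ∧
  image a.hom a.rule.pos ⊆ cur σ F h ∧
  Set.InjOn a.fresh a.rule.exVars ∧
  ∀ x ∈ a.rule.exVars, ∀ g, g <:+ h → a.fresh x ∉ vars (raw σ F g)

/-- `h` is a finite derivation from `F` with rules in `𝓡` and simplifications given by `σ`. -/
def IsHistory (σ : Simplifier ar Con Var) (F : Atomset ar Con Var) (𝓡 : Set (NMERule ar Con Var)) :
    List (App ar Con Var) → Prop
  | [] => True
  | a :: h => IsHistory σ F 𝓡 h ∧ Applicable σ F 𝓡 h a

end

/-- A chase criterion: it determines every simplification `σ_i` from the derivation so far, and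
`σ_i` is a retraction of `F_i`, i.e. an endomorphism of `F_i` that is the identity on its image. -/
structure Criterion {Pred : Type*} (ar : Pred → ℕ) (Con Var : Type*) where
  simp : Simplifier ar Con Var
  endo : ∀ F : Atomset ar Con Var, F.Finite → ∀ h, IsHistory simp F Set.univ h →
    cur simp F h ⊆ raw simp F h
  idem : ∀ F : Atomset ar Con Var, F.Finite → ∀ h, IsHistory simp F Set.univ h →
    ∀ x ∈ vars (raw simp F h), (simp F h x).subst (simp F h) = simp F h x

section

variable {Pred Con Var : Type*} {ar : Pred → ℕ}

/-- The application `a` after `h` produces something new: `σ_{i+1}(F_{i+1}) ⊈ σ_i(F_i)`. -/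
def Productive (C : Criterion ar Con Var) (F : Atomset ar Con Var)
    (h : List (App ar Con Var)) (a : App ar Con Var) : Prop :=
  ¬ cur C.simp F (a :: h) ⊆ cur C.simp F h

/-- A finite or infinite nonmonotonic `C`-chase from `F` with rules in `𝓡`, represented by the set
of its finite initial segments. Its simplifications are determined by `C`, and every application
that it makes produces something new. -/
structure IsChase (C : Criterion ar Con Var) (F : Atomset ar Con Var)
    (𝓡 : Set (NMERule ar Con Var)) (D : Set (List (App ar Con Var))) : Prop where
  nil_mem : [] ∈ D
  closed : ∀ h ∈ D, ∀ g, g <:+ h → g ∈ D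
  chain : IsChain (· <:+ ·) D
  history : ∀ h ∈ D, IsHistory C.simp F 𝓡 h
  productive : ∀ h a, a :: h ∈ D → Productive C F h a

/-- The finite derivation with history `h`, as the set of its initial segments. -/
def segments (h : List (App ar Con Var)) : Set (List (App ar Con Var)) :=
  {g | g <:+ h}

/-- The atomset `⋃ᵢ σ_i(F_i) \ ⋃ᵢ (F_i \ σ_i(F_i))` produced by a derivation. -/
def produced (C : Criterion ar Con Var) (F : Atomset ar Con Var)
    (D : Set (List (App ar Con Var))) : Atomset ar Con Var :=
  (⋃ h ∈ D, cur C.simp F h) \ (⋃ h ∈ D, raw C.simp F h \ cur C.simp F h)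

/-- `transport C F h t = σ_{i → j} = σ_j ∘ ⋯ ∘ σ_{i+1}`, where `h` is the derivation up to step `i`
and `t ++ h` the derivation up to step `j`. -/
def transport (C : Criterion ar Con Var) (F : Atomset ar Con Var) (h : List (App ar Con Var)) :
    List (App ar Con Var) → Subst Con Var
  | [] => .var
  | a :: t => fun x => (transport C F h t x).subst (C.simp F (a :: (t ++ h)))

/-- The application `a`, made after `h` in the derivation `D`, is blocked: one of its negative
bodies, as transformed by the simplifications, is found at the step of `a` or later. -/
def Blocked (C : Criterion ar Con Var) (F : Atomset ar Con Var) (D : Set (List (App ar Con Var)))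
    (h : List (App ar Con Var)) (a : App ar Con Var) : Prop :=
  ∃ q, ∃ t, t ++ h ∈ D ∧ image (transport C F h t) (a.negInst q) ⊆ cur C.simp F (t ++ h)

/-- No application made in the derivation is blocked. -/
def IsSound (C : Criterion ar Con Var) (F : Atomset ar Con Var)
    (D : Set (List (App ar Con Var))) : Prop :=
  ∀ h a, a :: h ∈ D → ¬ Blocked C F D h a

/-- Completeness of a sound derivation: for every homomorphism from the positive body of a rule of
`𝓡` to some `σ_i(F_i)`, there is a step `j ≥ i` such that adding the corresponding application
after step `j` (with any choice of the fresh variables, and productive or not) makes the derivation unsound or does not change the produced atomset. For a finite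
derivation it is equivalent to let `i` and `j` be its last step. -/
def IsComplete (C : Criterion ar Con Var) (F : Atomset ar Con Var)
    (𝓡 : Set (NMERule ar Con Var)) (D : Set (List (App ar Con Var))) : Prop :=
  IsSound C F D ∧
  ∀ h ∈ D, ∀ R ∈ 𝓡, ∀ π : Subst Con Var, image π R.pos ⊆ cur C.simp F h →
    ∃ t, t ++ h ∈ D ∧ ∀ a : App ar Con Var,
      a.rule = R →
      Set.EqOn a.hom (fun x => (π x).subst (transport C F h t)) (vars R.pos) →
      Applicable C.simp F 𝓡 (t ++ h) a →
      ¬ IsSound C F (segments (a :: (t ++ h))) ∨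
        produced C F (segments (a :: (t ++ h))) = produced C F (segments (t ++ h))

/-- `A` is `C`-stable for `(F, 𝓡)`. -/
def IsCStable (C : Criterion ar Con Var) (F : Atomset ar Con Var)
    (𝓡 : Set (NMERule ar Con Var)) (A : Atomset ar Con Var) : Prop :=
  ∃ D, IsChase C F 𝓡 D ∧ IsComplete C F 𝓡 D ∧ produced C F D = A

end

/-- An edge of a derivation tree, from a node to one of the children added for an application `a`:
to the positive child (`none`) or to the negative child for the `q`-th negative body (`some q`). -/
abbrev Edge {Pred : Type*} (ar : Pred → ℕ) (Con Var : Type*) :=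
  (a : App ar Con Var) × Option (Fin a.rule.k)

/-- A node is given by the path that leads to it from the root, last edge first; `N <:+ N'` says
that `N'` is `N` or a descendant of `N`. -/
abbrev Node {Pred : Type*} (ar : Pred → ℕ) (Con Var : Type*) := List (Edge ar Con Var)

section

variable {Pred Con Var : Type*} {ar : Pred → ℕ}

/-- The derivation encoded by the positive nodes on the path from the root to a node. -/
def Node.posHistory : Node ar Con Var → List (App ar Con Var)
  | [] => []
  | ⟨a, none⟩ :: N => a :: Node.posHistory N
  | ⟨_, some _⟩ :: N => Node.posHistory N

/-- The field `in`. -/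
noncomputable def Node.inn (C : Criterion ar Con Var) (F : Atomset ar Con Var)
    (N : Node ar Con Var) : Atomset ar Con Var :=
  cur C.simp F (Node.posHistory N)

/-- The field `out`, a set of forbidden atomsets. -/
def Node.out : Node ar Con Var → Set (Atomset ar Con Var)
  | [] => ∅
  | ⟨a, none⟩ :: N => Node.out N ∪ Set.range a.negInst
  | ⟨_, some _⟩ :: N => Node.out N

/-- The field `mbt`, the set of the atomsets that must be true. -/
def Node.mbt : Node ar Con Var → Set (Atomset ar Con Var)
  | [] => ∅
  | ⟨_, none⟩ :: N => Node.mbt N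
  | ⟨a, some q⟩ :: N => Node.mbt N ∪ {a.negInst q}

/-- A forbidden atomset has been inferred or has to be proven. -/
def Node.IsUnsound (C : Criterion ar Con Var) (F : Atomset ar Con Var)
    (N : Node ar Con Var) : Prop :=
  ∃ B ∈ Node.out N, B ⊆ Node.inn C F N ∪ ⋃₀ Node.mbt N

/-- `T` is (the set of nodes of) a `C`-derivation tree of `(F, 𝓡)`: it contains the root, and the
children of a node that has children are exactly the `k + 1` children for some application of a
rule of `𝓡` that is possible at this node, not blocked, and productive; moreover that node is not
unsound. -/
structure IsDerivationTree (C : Criterion ar Con Var) (F : Atomset ar Con Var)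
    (𝓡 : Set (NMERule ar Con Var)) (T : Set (Node ar Con Var)) : Prop where
  root_mem : [] ∈ T
  closed : ∀ e N, e :: N ∈ T → N ∈ T
  children : ∀ N, (∃ e, e :: N ∈ T) →
    ¬ Node.IsUnsound C F N ∧
    ∃ a : App ar Con Var,
      Applicable C.simp F 𝓡 (Node.posHistory N) a ∧
      (∀ q, ¬ a.negInst q ⊆ Node.inn C F N) ∧
      Productive C F (Node.posHistory N) a ∧
      ∀ e : Edge ar Con Var, e :: N ∈ T ↔ e.1 = a

/-- A branch: a finite or infinite maximal path from the root. -/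
def IsBranch (T b : Set (Node ar Con Var)) : Prop :=
  b ⊆ T ∧ IsChain (· <:+ ·) b ∧ ∀ c ⊆ T, IsChain (· <:+ ·) c → b ⊆ c → c = b

/-- The derivation associated with a branch. -/
def branchDerivation (b : Set (Node ar Con Var)) : Set (List (App ar Con Var)) :=
  Node.posHistory '' b

def IsUnsoundBranch (C : Criterion ar Con Var) (F : Atomset ar Con Var)
    (b : Set (Node ar Con Var)) : Prop :=
  ∃ N ∈ b, Node.IsUnsound C F N

def IsCompleteBranch (C : Criterion ar Con Var) (F : Atomset ar Con Var)
    (𝓡 : Set (NMERule ar Con Var)) (b : Set (Node ar Con Var)) : Prop :=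
  ¬ IsUnsoundBranch C F b ∧ IsComplete C F 𝓡 (branchDerivation b)

/-- A sound and complete branch in which everything that must be true is eventually proven. -/
def IsStableBranch (C : Criterion ar Con Var) (F : Atomset ar Con Var)
    (𝓡 : Set (NMERule ar Con Var)) (b : Set (Node ar Con Var)) : Prop :=
  IsCompleteBranch C F 𝓡 b ∧
  ∀ N ∈ b, ∀ B ∈ Node.mbt N, ∃ N' ∈ b, N <:+ N' ∧ B ⊆ Node.inn C F N'

/-- Some node `N` of the branch has an atomset that must be true, and no complete branch of the
tree that contains `N` is stable. -/
def IsUnprovableBranch (C : Criterion ar Con Var) (F : Atomset ar Con Var)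
    (𝓡 : Set (NMERule ar Con Var)) (T b : Set (Node ar Con Var)) : Prop :=
  ∃ N ∈ b, (Node.mbt N).Nonempty ∧
    ∀ c, IsBranch T c → N ∈ c → IsCompleteBranch C F 𝓡 c → ¬ IsStableBranch C F 𝓡 c

/-- A `C`-chase tree of `(F, 𝓡)`. -/
def IsChaseTree (C : Criterion ar Con Var) (F : Atomset ar Con Var)
    (𝓡 : Set (NMERule ar Con Var)) (T : Set (Node ar Con Var)) : Prop :=
  IsDerivationTree C F 𝓡 T ∧
  ∀ b, IsBranch T b →
    IsUnsoundBranch C F b ∨ IsUnprovableBranch C F 𝓡 T b ∨ IsCompleteBranch C F 𝓡 b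

end

end ChaseTree

/-! A complete sound chase becomes a tree (`treeOfChase`) made of its applications as a positive
path, with all negative children on the way left as leaves. On the path MBT is empty, so stability
there is vacuous. Any other branch ends in a negative leaf whose MBT holds some `π(B⁻_q)`; a stable
branch would have to contain that set in IN of this very leaf, which soundness excludes, so the
branch is unprovable. Conversely, the derivation of a branch is a chase (`IsBranch.isChase`), and
completeness is part of being stable.

The delicate point is that soundness of derivations tests transported sets `σ_{i→j}(π(B⁻_q))`,
whereas trees test `π(B⁻_q)` itself. If `π(B⁻_q)` lies in a later atomset, its variables, already
present at step `i` by safety, are present at step `j`. A vanished variable never returns, by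
freshness, so they survive every intermediate simplification, and a retraction fixes the variables
of its image. Hence transport is the identity on that set (`image_transport_negInst`,
`not_negInst_subset`). -/

namespace ChaseTree

/-! ### Substitutions and variables of atomsets -/

section Substitutions

variable {Pred Con Var : Type*} {ar : Pred → ℕ}

theorem Term.subst_var (t : Term Con Var) : t.subst .var = t := by
  cases t <;> rfl

theorem Atom.subst_eq_self {s : Subst Con Var} {p : Atom ar Con Var}
    (h : ∀ i x, p.args i = .var x → s x = .var x) : p.subst s = p := by
  obtain ⟨r, args⟩ := p
  simp only [Atom.subst, Atom.mk.injEq, heq_eq_eq, true_and]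
  funext i
  cases hi : args i with
  | con c => rfl
  | var x => exact h i x hi

theorem image_eq_self {s : Subst Con Var} {B : Atomset ar Con Var}
    (h : ∀ x ∈ vars B, s x = .var x) : image s B = B := by
  have : ∀ p ∈ B, p.subst s = p := fun p hp =>
    Atom.subst_eq_self fun i x hx => h x ⟨p, hp, i, hx⟩
  exact (Set.image_congr this).trans (Set.image_id' B)

theorem vars_mono {A B : Atomset ar Con Var} (h : A ⊆ B) : vars A ⊆ vars B :=
  fun _ ⟨p, hp, i, hi⟩ => ⟨p, h hp, i, hi⟩

theorem mem_vars_image {s : Subst Con Var} {B : Atomset ar Con Var} {y : Var} :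
    y ∈ vars (image s B) ↔ ∃ x ∈ vars B, s x = .var y := by
  constructor
  · rintro ⟨_, ⟨p, hp, rfl⟩, i, hi⟩
    cases hx : p.args i with
    | con c => simp [Atom.subst, hx, Term.subst] at hi
    | var x => exact ⟨x, ⟨p, hp, i, hx⟩, by simpa [Atom.subst, hx, Term.subst] using hi⟩
  · rintro ⟨x, ⟨p, hp, i, hi⟩, hx⟩
    exact ⟨p.subst s, ⟨p, hp, rfl⟩, i, by simp [Atom.subst, hi, Term.subst, hx]⟩

theorem mem_vars_union {A B : Atomset ar Con Var} {y : Var} :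
    y ∈ vars (A ∪ B) ↔ y ∈ vars A ∨ y ∈ vars B := by
  constructor
  · rintro ⟨p, hp | hp, i, hi⟩
    · exact .inl ⟨p, hp, i, hi⟩
    · exact .inr ⟨p, hp, i, hi⟩
  · rintro (h | h)
    · exact vars_mono Set.subset_union_left h
    · exact vars_mono Set.subset_union_right h

end Substitutions

/-! ### Persistence of variables, and soundness without transport -/

section Derivations

variable {Pred Con Var : Type*} {ar : Pred → ℕ} {σ : Simplifier ar Con Var}
  {C : Criterion ar Con Var} {F : Atomset ar Con Var} {𝓡 : Set (NMERule ar Con Var)}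

theorem IsHistory.univ {h : List (App ar Con Var)} (hh : IsHistory σ F 𝓡 h) :
    IsHistory σ F Set.univ h := by
  induction h with
  | nil => trivial
  | cons a h ih => exact ⟨ih hh.1, trivial, hh.2.2⟩

theorem IsHistory.of_append {h t : List (App ar Con Var)} (hh : IsHistory σ F 𝓡 (t ++ h)) :
    IsHistory σ F 𝓡 h := by
  induction t with
  | nil => exact hh
  | cons a t ih => exact ih hh.1

theorem vars_negInst_subset {h : List (App ar Con Var)} {a : App ar Con Var}
    (ha : Applicable σ F 𝓡 h a) (q : Fin a.rule.k) : vars (a.negInst q) ⊆ vars (cur σ F h) := by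
  intro y hy
  obtain ⟨x, hx, hxy⟩ := mem_vars_image.1 hy
  exact vars_mono ha.2.1 (mem_vars_image.2 ⟨x, a.rule.safe q hx, hxy⟩)

/-- An application does not reintroduce a variable that has disappeared. -/
theorem Applicable.mem_vars_cur {g h : List (App ar Con Var)} {a : App ar Con Var}
    (ha : Applicable σ F 𝓡 h a) (hg : g <:+ h) {y : Var} (hyg : y ∈ vars (raw σ F g))
    (hy : y ∈ vars (raw σ F (a :: h))) : y ∈ vars (cur σ F h) := by
  rcases mem_vars_union.1 hy with hy | hy
  · exact hy
  · obtain ⟨x, hx, hxy⟩ := mem_vars_image.1 hy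
    by_cases hp : x ∈ vars a.rule.pos
    · rw [if_pos hp] at hxy
      exact vars_mono ha.2.1 (mem_vars_image.2 ⟨x, hp, hxy⟩)
    · rw [if_neg hp, Term.var.injEq] at hxy
      exact absurd (hxy ▸ hyg) (ha.2.2.2 x ⟨hx, hp⟩ g hg)

/-- Such a `y` is the value of the simplification at some variable of the unsimplified atomset, so
idempotence applies. -/
theorem simp_eq_var (hF : F.Finite) {h : List (App ar Con Var)}
    (hh : IsHistory C.simp F Set.univ h) {y : Var} (hy : y ∈ vars (cur C.simp F h)) :
    C.simp F h y = .var y := by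
  obtain ⟨x, hx, hxy⟩ := mem_vars_image.1 hy
  simpa [hxy, Term.subst] using C.idem F hF h hh x hx

theorem transport_eq_var (hF : F.Finite) {h t : List (App ar Con Var)}
    (hh : IsHistory C.simp F Set.univ (t ++ h)) {y : Var} (hy : y ∈ vars (cur C.simp F h))
    (hyt : y ∈ vars (cur C.simp F (t ++ h))) : transport C F h t y = .var y := by
  induction t with
  | nil => rfl
  | cons a t ih =>
    -- Presence at the last step is propagated backwards: `y` must already occur just before `a`,
    -- since `a` cannot bring it back.
    have hraw := vars_mono (C.endo F hF h hh.of_append) hy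
    have hyt' := hh.2.mem_vars_cur ⟨t, rfl⟩ hraw (vars_mono (C.endo F hF _ hh) hyt)
    simp only [transport, ih hh.1 hyt', Term.subst]
    exact simp_eq_var hF hh hyt

/-- A forbidden atomset that is found in a later step is not changed by the simplifications made
in the meantime. -/
theorem image_transport_negInst (hF : F.Finite) {h t : List (App ar Con Var)} {a : App ar Con Var}
    (hh : IsHistory C.simp F Set.univ (t ++ h)) (ha : Applicable C.simp F 𝓡 h a)
    {q : Fin a.rule.k} (hq : a.negInst q ⊆ cur C.simp F (t ++ h)) :
    image (transport C F h t) (a.negInst q) = a.negInst q :=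
  image_eq_self fun _ hx =>
    transport_eq_var hF hh (vars_negInst_subset ha q hx) (vars_mono hq hx)

/-- Turns the transported test of soundness into the plain inclusion test used for OUT. -/
theorem not_negInst_subset (hF : F.Finite) {D : Set (List (App ar Con Var))}
    (hD : IsChase C F 𝓡 D) (hS : IsSound C F D) {h t : List (App ar Con Var)}
    {a : App ar Con Var} (ha : a :: h ∈ D) (ht : t ++ h ∈ D) (q : Fin a.rule.k) :
    ¬ a.negInst q ⊆ cur C.simp F (t ++ h) := fun hq =>
  hS h a ha ⟨q, t, ht, by
    rwa [image_transport_negInst hF (hD.history _ ht).univ (hD.history _ ha).2 hq]⟩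

theorem IsChase.cons_unique {D : Set (List (App ar Con Var))} (hD : IsChase C F 𝓡 D)
    {h : List (App ar Con Var)} {a a' : App ar Con Var} (ha : a :: h ∈ D) (ha' : a' :: h ∈ D) :
    a = a' := by
  rcases hD.chain.total ha ha' with H | H
  · exact (List.cons.inj (H.eq_of_length rfl)).1
  · exact (List.cons.inj (H.eq_of_length rfl)).1.symm

end Derivations

/-! ### From branches to chases -/

section Branches

variable {Pred Con Var : Type*} {ar : Pred → ℕ}
  {C : Criterion ar Con Var} {F : Atomset ar Con Var} {𝓡 : Set (NMERule ar Con Var)}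
  {T b : Set (Node ar Con Var)}

theorem IsBranch.mem_of_comparable (hb : IsBranch T b) {M : Node ar Con Var} (hM : M ∈ T)
    (h : ∀ K ∈ b, M <:+ K ∨ K <:+ M) : M ∈ b := by
  have := hb.2.2 (insert M b) (Set.insert_subset hM hb.1)
    (hb.2.1.insert fun K hK _ => h K hK) (Set.subset_insert M b)
  exact this ▸ Set.mem_insert M b

theorem IsDerivationTree.suffix_mem (hT : IsDerivationTree C F 𝓡 T) {M N : Node ar Con Var}
    (h : M <:+ N) (hN : N ∈ T) : M ∈ T := by
  obtain ⟨t, rfl⟩ := h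
  induction t with
  | nil => exact hN
  | cons e t ih => exact ih (hT.closed e _ hN)

theorem IsBranch.suffix_mem (hT : IsDerivationTree C F 𝓡 T) (hb : IsBranch T b)
    {M N : Node ar Con Var} (h : M <:+ N) (hN : N ∈ b) : M ∈ b := by
  refine hb.mem_of_comparable (hT.suffix_mem h (hb.1 hN)) fun K hK => ?_
  rcases hb.2.1.total hN hK with H | H
  · exact .inl (h.trans H)
  · exact List.suffix_or_suffix_of_suffix h H

theorem IsBranch.nil_mem (hT : IsDerivationTree C F 𝓡 T) (hb : IsBranch T b) : [] ∈ b :=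
  hb.mem_of_comparable hT.root_mem fun _ _ => .inl (List.nil_suffix)

theorem Node.posHistory_append (M N : Node ar Con Var) :
    Node.posHistory (M ++ N) = Node.posHistory M ++ Node.posHistory N := by
  induction M with
  | nil => rfl
  | cons e M ih =>
    obtain ⟨a, _ | q⟩ := e
    · exact congrArg (a :: ·) ih
    · exact ih

theorem Node.posHistory_suffix {M N : Node ar Con Var} (h : M <:+ N) :
    Node.posHistory M <:+ Node.posHistory N := by
  obtain ⟨t, rfl⟩ := h
  exact ⟨Node.posHistory t, (Node.posHistory_append t M).symm⟩

/-- Skips the negative edges below the last positive one, so that initial segments of the derivation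
lift to nodes of the branch. -/
theorem Node.exists_suffix_of_posHistory_eq_cons {N : Node ar Con Var} {a : App ar Con Var}
    {h : List (App ar Con Var)} (hN : Node.posHistory N = a :: h) :
    ∃ M, Node.posHistory M = h ∧ ⟨a, none⟩ :: M <:+ N := by
  induction N with
  | nil => cases hN
  | cons e N ih =>
    obtain ⟨a', _ | q⟩ := e
    · obtain ⟨rfl, rfl⟩ := List.cons.inj hN
      exact ⟨N, rfl, List.suffix_rfl⟩
    · obtain ⟨M, hM, hMN⟩ := ih hN
      exact ⟨M, hM, hMN.trans (List.suffix_cons _ _)⟩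

theorem IsDerivationTree.applicable (hT : IsDerivationTree C F 𝓡 T) {N : Node ar Con Var}
    {e : Edge ar Con Var} (he : e :: N ∈ T) :
    Applicable C.simp F 𝓡 (Node.posHistory N) e.1 ∧ Productive C F (Node.posHistory N) e.1 := by
  obtain ⟨-, a, h1, -, h2, h3⟩ := hT.children N ⟨e, he⟩
  rw [(h3 e).1 he]
  exact ⟨h1, h2⟩

theorem IsDerivationTree.isHistory (hT : IsDerivationTree C F 𝓡 T) {N : Node ar Con Var}
    (hN : N ∈ T) : IsHistory C.simp F 𝓡 (Node.posHistory N) := by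
  induction N with
  | nil => trivial
  | cons e N ih =>
    have hN' := ih (hT.closed e N hN)
    have happ := (hT.applicable hN).1
    obtain ⟨a, _ | q⟩ := e
    · exact ⟨hN', happ⟩
    · exact hN'

/-- The derivation associated with a branch of a derivation tree is a chase. -/
theorem IsBranch.isChase (hT : IsDerivationTree C F 𝓡 T) (hb : IsBranch T b) :
    IsChase C F 𝓡 (branchDerivation b) where
  nil_mem := ⟨[], hb.nil_mem hT, rfl⟩
  closed := by
    rintro _ ⟨N, hN, rfl⟩ g ⟨t, ht⟩
    induction t generalizing N with
    | nil => exact ⟨N, hN, ht.symm⟩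
    | cons a t ih =>
      obtain ⟨M, hM, hMN⟩ := Node.exists_suffix_of_posHistory_eq_cons ht.symm
      exact ih M (hb.suffix_mem hT ((List.suffix_cons _ _).trans hMN) hN) hM.symm
  chain := by
    rintro _ ⟨N, hN, rfl⟩ _ ⟨N', hN', rfl⟩ -
    exact (hb.2.1.total hN hN').imp Node.posHistory_suffix Node.posHistory_suffix
  history := by
    rintro _ ⟨N, hN, rfl⟩
    exact hT.isHistory (hb.1 hN)
  productive := by
    rintro _ a ⟨N, hN, hNa⟩
    obtain ⟨M, rfl, hMN⟩ := Node.exists_suffix_of_posHistory_eq_cons hNa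
    exact (hT.applicable (hT.suffix_mem hMN (hb.1 hN))).2

end Branches

/-! ### From a complete sound chase to a chase tree -/

section TreeOfChase

variable {Pred Con Var : Type*} {ar : Pred → ℕ}
  {C : Criterion ar Con Var} {F : Atomset ar Con Var} {𝓡 : Set (NMERule ar Con Var)}
  {D : Set (List (App ar Con Var))}

/-- The node reached from the root by positive edges for the applications of `h`. -/
def posNode (h : List (App ar Con Var)) : Node ar Con Var :=
  h.map fun a => ⟨a, none⟩

/-- The negative children along the positive path of a derivation. -/
def negSiblings (D : Set (List (App ar Con Var))) : Set (Node ar Con Var) :=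
  {N | ∃ h a, ∃ q : Fin a.rule.k, a :: h ∈ D ∧ N = ⟨a, some q⟩ :: posNode h}

/-- The tree that consists of the positive path of a derivation and of the negative siblings of
the nodes on this path, which are leaves. -/
def treeOfChase (D : Set (List (App ar Con Var))) : Set (Node ar Con Var) :=
  posNode '' D ∪ negSiblings D

theorem posNode_injective : Function.Injective (posNode (ar := ar) (Con := Con) (Var := Var)) :=
  List.map_injective_iff.2 fun _ _ h => congrArg Sigma.fst h

@[simp] theorem posHistory_posNode (h : List (App ar Con Var)) :
    Node.posHistory (posNode h) = h := by
  induction h with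
  | nil => rfl
  | cons a h ih => exact congrArg (a :: ·) ih

@[simp] theorem mbt_posNode (h : List (App ar Con Var)) : Node.mbt (posNode h) = ∅ := by
  induction h with
  | nil => rfl
  | cons a h ih => exact ih

theorem exists_of_mem_out_posNode {h : List (App ar Con Var)} {B : Atomset ar Con Var}
    (hB : B ∈ Node.out (posNode h)) : ∃ g a, ∃ q, a :: g <:+ h ∧ a.negInst q = B := by
  induction h with
  | nil => exact hB.elim
  | cons a h ih =>
    rcases hB with hB | ⟨q, hq⟩
    · obtain ⟨g, a', q, hg, hq⟩ := ih hB
      exact ⟨g, a', q, hg.trans (List.suffix_cons _ _), hq⟩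
    · exact ⟨h, a, q, List.suffix_rfl, hq⟩

theorem branchDerivation_posNode (D : Set (List (App ar Con Var))) :
    branchDerivation (posNode '' D) = D := by
  simp [branchDerivation, Set.image_image]

theorem not_isUnsound_posNode (hF : F.Finite) (hD : IsChase C F 𝓡 D) (hS : IsSound C F D)
    {h : List (App ar Con Var)} (hh : h ∈ D) : ¬ Node.IsUnsound C F (posNode h) := by
  rintro ⟨B, hB, hsub⟩
  obtain ⟨g, a, q, hg, rfl⟩ := exists_of_mem_out_posNode hB
  obtain ⟨t, rfl⟩ := (List.suffix_cons a g).trans hg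
  refine not_negInst_subset hF hD hS (hD.closed _ hh _ hg) hh q ?_
  simpa [Node.inn] using hsub

theorem cons_posNode_mem {h : List (App ar Con Var)} {e : Edge ar Con Var} :
    e :: posNode h ∈ treeOfChase D ↔ e.1 :: h ∈ D := by
  constructor
  · rintro (⟨_ | ⟨a, g⟩, hg, heq⟩ | ⟨g, a, q, hg, heq⟩)
    · cases heq
    · obtain ⟨rfl, h2⟩ := List.cons.inj heq
      exact posNode_injective h2 ▸ hg
    · obtain ⟨rfl, h2⟩ := List.cons.inj heq
      exact posNode_injective h2 ▸ hg
  · intro he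
    obtain ⟨a, _ | q⟩ := e
    · exact .inl ⟨a :: h, he, rfl⟩
    · exact .inr ⟨h, a, q, he, rfl⟩

/-- Only nodes of the positive path have children; in particular negative siblings are leaves. -/
theorem exists_eq_posNode_of_cons_mem {N : Node ar Con Var} {e : Edge ar Con Var}
    (hD : ∀ h ∈ D, ∀ g, g <:+ h → g ∈ D) (he : e :: N ∈ treeOfChase D) :
    ∃ h ∈ D, N = posNode h := by
  rcases he with ⟨_ | ⟨a, g⟩, hg, heq⟩ | ⟨g, a, q, hg, heq⟩
  · cases heq
  · exact ⟨g, hD _ hg _ (List.suffix_cons _ _), (List.cons.inj heq).2.symm⟩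
  · exact ⟨g, hD _ hg _ (List.suffix_cons _ _), (List.cons.inj heq).2⟩

theorem some_cons_ne_posNode {a : App ar Con Var} {q : Fin a.rule.k} {N : Node ar Con Var}
    (h : List (App ar Con Var)) : (⟨a, some q⟩ :: N : Node ar Con Var) ≠ posNode h := by
  cases h with
  | nil => exact List.cons_ne_nil _ _
  | cons a' h =>
    intro heq
    have h1 := (List.cons.inj heq).1
    obtain ⟨rfl, h2⟩ := Sigma.mk.inj h1
    cases h2

theorem isDerivationTree_treeOfChase (hF : F.Finite) (hD : IsChase C F 𝓡 D)
    (hS : IsSound C F D) : IsDerivationTree C F 𝓡 (treeOfChase D) where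
  root_mem := .inl ⟨[], hD.nil_mem, rfl⟩
  closed := by
    intro e N he
    obtain ⟨h, hh, rfl⟩ := exists_eq_posNode_of_cons_mem hD.closed he
    exact .inl ⟨h, hh, rfl⟩
  children := by
    rintro N ⟨e, he⟩
    obtain ⟨h, hh, rfl⟩ := exists_eq_posNode_of_cons_mem hD.closed he
    have ha := (cons_posNode_mem).1 he
    refine ⟨not_isUnsound_posNode hF hD hS hh, e.1, ?_, fun q => ?_, ?_, fun e' => ?_⟩
    · simpa using (hD.history _ ha).2
    · simpa [Node.inn] using not_negInst_subset (t := []) hF hD hS ha hh q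
    · simpa using hD.productive _ _ ha
    · rw [cons_posNode_mem]
      exact ⟨fun h' => hD.cons_unique h' ha, fun h' => h' ▸ ha⟩

theorem isChain_posNode (hD : IsChase C F 𝓡 D) : IsChain (· <:+ ·) (posNode '' D) := by
  rintro _ ⟨h, hh, rfl⟩ _ ⟨h', hh', rfl⟩ -
  exact (hD.chain.total hh hh').imp (fun H => H.map _) (fun H => H.map _)

theorem isBranch_posNode (hD : IsChase C F 𝓡 D) :
    IsBranch (treeOfChase D) (posNode '' D) := by
  refine ⟨Set.subset_union_left, isChain_posNode hD, fun c hcT hc hDc => ?_⟩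
  refine Set.Subset.antisymm (fun N hN => (hcT hN).resolve_right ?_) hDc
  rintro ⟨h, a, q, ha, rfl⟩
  -- The positive and negative children for `a` have the same length, so in a chain they would
  -- coincide.
  have hpos : posNode (a :: h) ∈ c := hDc ⟨_, ha, rfl⟩
  rcases hc.total hN hpos with H | H
  · exact some_cons_ne_posNode (a :: h) (H.eq_of_length rfl)
  · exact some_cons_ne_posNode (a :: h) (H.eq_of_length rfl).symm

theorem isStableBranch_posNode (hF : F.Finite) (hD : IsChase C F 𝓡 D)
    (hC : IsComplete C F 𝓡 D) : IsStableBranch C F 𝓡 (posNode '' D) := by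
  refine ⟨⟨?_, by rwa [branchDerivation_posNode]⟩, ?_⟩
  · rintro ⟨_, ⟨h, hh, rfl⟩, hN⟩
    exact not_isUnsound_posNode hF hD hC.1 hh hN
  · rintro _ ⟨h, hh, rfl⟩ B hB
    simp at hB

theorem isUnprovableBranch_treeOfChase (hF : F.Finite) (hD : IsChase C F 𝓡 D)
    (hS : IsSound C F D) {b : Set (Node ar Con Var)} {N : Node ar Con Var} (hNb : N ∈ b)
    (hN : N ∈ negSiblings D) : IsUnprovableBranch C F 𝓡 (treeOfChase D) b := by
  obtain ⟨h, a, q, ha, rfl⟩ := hN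
  have hmem : a.negInst q ∈ Node.mbt (⟨a, some q⟩ :: posNode h : Node ar Con Var) := .inr rfl
  refine ⟨_, hNb, ⟨_, hmem⟩, fun c hcT hNc _ hst => ?_⟩
  obtain ⟨N', hN', ⟨t, rfl⟩, hsub⟩ := hst.2 _ hNc _ hmem
  cases t with
  | nil =>
    refine not_negInst_subset (t := []) hF hD hS ha
      (hD.closed _ ha _ (List.suffix_cons _ _)) q ?_
    simpa [Node.inn, Node.posHistory] using hsub
  | cons e t =>
    have hT := isDerivationTree_treeOfChase hF hD hS
    -- Edges are listed last first, so `e'` is the edge leaving the negative sibling, which is a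
    -- leaf.
    obtain ⟨s, e', hs⟩ : ∃ s e', e :: t = s ++ [e'] :=
      ⟨_, _, (List.dropLast_append_getLast (List.cons_ne_nil e t)).symm⟩
    have hmemT : e' :: ⟨a, some q⟩ :: posNode h ∈ treeOfChase D :=
      hT.suffix_mem ⟨s, by rw [hs]; simp⟩ (hcT.1 hN')
    obtain ⟨g, -, hg⟩ := exists_eq_posNode_of_cons_mem hD.closed hmemT
    exact some_cons_ne_posNode g hg

theorem isChaseTree_treeOfChase (hF : F.Finite) (hD : IsChase C F 𝓡 D)
    (hC : IsComplete C F 𝓡 D) : IsChaseTree C F 𝓡 (treeOfChase D) := by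
  refine ⟨isDerivationTree_treeOfChase hF hD hC.1, fun b hb => .inr ?_⟩
  by_cases h : ∃ N ∈ b, N ∈ negSiblings D
  · obtain ⟨N, hNb, hN⟩ := h
    exact .inl (isUnprovableBranch_treeOfChase hF hD hC.1 hNb hN)
  · have hsub : b ⊆ posNode '' D := fun N hN =>
      (hb.1 hN).resolve_right fun h' => h ⟨N, hN, h'⟩
    -- A branch without negative siblings is, by maximality, the whole positive path.
    rw [← hb.2.2 _ Set.subset_union_left (isChain_posNode hD) hsub]
    exact .inr (isStableBranch_posNode hF hD hC).1

end TreeOfChase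

end ChaseTree

theorem mainTheorem10 {Pred Con Var : Type*} [Infinite Var] {ar : Pred → ℕ}
    (C : ChaseTree.Criterion ar Con Var)
    (F : ChaseTree.Atomset ar Con Var) (hF : F.Finite)
    (𝓡 : Set (ChaseTree.NMERule ar Con Var)) (A : ChaseTree.Atomset ar Con Var) :
    ChaseTree.IsCStable C F 𝓡 A ↔
      ∃ T, ChaseTree.IsChaseTree C F 𝓡 T ∧
        ∃ b, ChaseTree.IsBranch T b ∧ ChaseTree.IsStableBranch C F 𝓡 b ∧
          ChaseTree.produced C F (ChaseTree.branchDerivation b) = A := by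
  constructor
  · rintro ⟨D, hD, hC, rfl⟩
    exact ⟨_, ChaseTree.isChaseTree_treeOfChase hF hD hC, _, ChaseTree.isBranch_posNode hD,
      ChaseTree.isStableBranch_posNode hF hD hC, by rw [ChaseTree.branchDerivation_posNode]⟩
  · rintro ⟨T, hT, b, hb, hst, rfl⟩
    exact ⟨_, hb.isChase hT.1, hst.1.2, rfl⟩
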